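/- Fix a constant $\eta>0$ (the stabilizing constant of all layer normalizations below). Let $X,Y$ be real Banach spaces, let $T:X\to Y$ be a continuous, possibly nonlinear, operator and let $K\subset X$ be compact. Then for every $\varepsilon>0$ there is a Leray--Schauder transformer $\mathfrak T:X\to Y$ for $K$ such that $$\|T(x)-\mathfrak T(x)\|_Y<\varepsilon\qquad\text{for all }x\in K .$$ Here the notions are as follows. \emph{Leray--Schauder mapping.} Let $\delta>0$ and let $x_1,\dots,x_N\in K$ be a finite $\delta$-net of $K$, i.e. every $z\in K$ has $\|z-x_i\|<\delta$ for some $i$. Put $E=\mathrm{span}(x_1,\dots,x_N)$, $\mu_i(z)=\max(\delta-\|z-x_i\|,0)$ and $$P:X\to E,\qquad P(z)=\frac{\sum_{i=1}^N\mu_i(z)\,x_i}{\sum_{i=1}^N\mu_i(z)}$$ (the denominator is positive on $K$; where it vanishes, $P(z)=0$). \emph{Transformer.} A transformer on sequences of $n$ scalar tokens is a map $W:\mathbb R^n\to\mathbb R^n$ of the following form. With $a\in\mathbb R^d$ and positional encodings $p_1,\dots,p_n\in\mathbb R^d$, form $Z^{(0)}\in\mathbb R^{n\times d}$ with rows $s_i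 a+p_i$. Apply a finite number of layers $Z\mapsto Z''$, where $$Z'_i=\mathrm{LN}_1\big(Z_i+\mathrm{MultiHead}(Z)_i\big),\qquad Z''_i=\mathrm{LN}_2\big(Z'_i+\mathrm{FFN}(Z'_i)\big),$$ $\mathrm{MultiHead}(Z)=\mathrm{Concat}(h_1,\dots,h_H)W^O$, $h_j=\mathrm{softmax}\big(ZW^Q_j(ZW^K_j)^{\top}/\sqrt{d_k}\big)ZW^V_j$ (softmax of each row), $\mathrm{FFN}(z)=\mathrm{ReLU}(zW_1+b_1)W_2+b_2$, and $\mathrm{LN}(v)=g\odot\frac{v-\mathrm{mean}(v)}{\sqrt{\mathrm{var}(v)+\eta}}+b$ with gain $g$ and bias $b$ in $\mathbb R^d$. Finally $W(s)_i=\langle Z_i,w\rangle+c$, where $Z$ is the output of the last layer, $w\in\mathbb R^d$ and $c\in\mathbb R$. The number of layers, $d,H,d_k,d_v$, the width of the feedforward networks, and all weights (different in different layers) are parameters of the transformer. \emph{Contextual mapping.} A map $q$ with values in $\mathbb R^n$ is a contextual mapping on a finite set $S\subset\mathbb R^n$ if, for each $s\in S$, the $n$ entries of $q(s)$ are distinct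 and, for $s\ne t$ in $S$, every entry of $q(s)$ differs from every entry of $q(t)$. A transformer has a contextual mapping on $S$ if for one of its layers there is $u\in\mathbb R^d$ such that $s\mapsto(\langle Z'_i(s),u\rangle)_{i=1}^n$ is a contextual mapping on $S$, where $Z'(s)$ is the output of the self-attention sublayer of this layer when the input of the transformer is $s$. \emph{Leray--Schauder transformer.} A Leray--Schauder transformer for $K$ is a map $$\mathfrak T(z)=\sum_{i=1}^n W\big(\varphi(P(z))\big)_i\,y_i ,$$ where $P:X\to E$ is the Leray--Schauder mapping of a finite $\delta$-net $x_1,\dots,x_N$ of $K$ for some $\delta>0$, $n\ge\max(2,\dim E)$, the map $\varphi:E\to\mathbb R^n$ sends a vector to its coordinates in a chosen basis of $E$, padded with zeros, $W$ is a transformer on sequences of $n$ scalar tokens with a contextual mapping on $\{\varphi(x_1),\dots,\varphi(x_N)\}$, and $y_1,\dots,y_n\in Y$. -/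

import Mathlib

open scoped Matrix

noncomputable section

/-! ### Leray-Schauder mappings -/

section LeraySchauder

variable {X : Type*} [NormedAddCommGroup X] [NormedSpace ℝ X]

/-- `x 0, …, x (N-1)` is a finite `δ`-net of `K`: the points lie in `K`, and every point of `K`
has distance less than `δ` to one of them. -/
def IsFiniteNet (K : Set X) (δ : ℝ) {N : ℕ} (x : Fin N → X) : Prop :=
  (∀ i, x i ∈ K) ∧ ∀ z ∈ K, ∃ i, ‖z - x i‖ < δ

/-- The weight `μ_i(z)`, equal to `δ - ‖z - x_i‖` if `‖z - x_i‖ ≤ δ` and to `0` otherwise. -/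
def lsWeight (δ : ℝ) {N : ℕ} (x : Fin N → X) (i : Fin N) (z : X) : ℝ :=
  if ‖z - x i‖ ≤ δ then δ - ‖z - x i‖ else 0

/-- The Leray-Schauder mapping `P z = (∑ i, μ_i(z) x_i) / (∑ i, μ_i(z))`, with values in the span
of the `x_i`. The denominator is positive on any set of which `x` is a `δ`-net. -/
def lsMap (δ : ℝ) {N : ℕ} (x : Fin N → X) (z : X) : Submodule.span ℝ (Set.range x) :=
  (∑ i, lsWeight δ x i z)⁻¹ •
    ∑ i, lsWeight δ x i z •
      (⟨x i, Submodule.subset_span (Set.mem_range_self i)⟩ : Submodule.span ℝ (Set.range x))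

end LeraySchauder

/-! ### Transformers

A sequence of `n` vectors of `ℝ^d` is a matrix with `n` rows, the row `i` being the token at
position `i`. -/

/-- `softmax`, applied to each row. -/
def rowSoftmax {n : ℕ} (S : Matrix (Fin n) (Fin n) ℝ) : Matrix (Fin n) (Fin n) ℝ :=
  fun i j => Real.exp (S i j) / ∑ k, Real.exp (S i k)

/-- `Attention(Q, K, V) = softmax (Q Kᵀ / √d_k) V`. -/
def attention {n dk dv : ℕ} (Q K : Matrix (Fin n) (Fin dk) ℝ) (V : Matrix (Fin n) (Fin dv) ℝ) :
    Matrix (Fin n) (Fin dv) ℝ :=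
  rowSoftmax ((Real.sqrt dk)⁻¹ • (Q * Kᵀ)) * V

/-- The arithmetic mean of the coordinates of a vector. -/
def vecMean {d : ℕ} (v : Fin d → ℝ) : ℝ := (∑ j, v j) / d

/-- The variance of the coordinates of a vector. -/
def vecVar {d : ℕ} (v : Fin d → ℝ) : ℝ := (∑ j, (v j - vecMean v) ^ 2) / d

/-- Layer normalization of one token, with stabilizing constant `η`, gain `g` and bias `b`. -/
def layerNorm {d : ℕ} (η : ℝ) (g b : Fin d → ℝ) (v : Fin d → ℝ) : Fin d → ℝ :=
  fun j => g j * ((v j - vecMean v) / Real.sqrt (vecVar v + η)) + b j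

/-- The parameters of one transformer layer of model width `d`, with `H` heads of key dimension
`dk` and value dimension `dv`, and a feedforward network of hidden width `dff`. -/
structure TransformerLayer (d H dk dv dff : ℕ) where
  WQ : Fin H → Matrix (Fin d) (Fin dk) ℝ
  WK : Fin H → Matrix (Fin d) (Fin dk) ℝ
  WV : Fin H → Matrix (Fin d) (Fin dv) ℝ
  WO : Matrix (Fin H × Fin dv) (Fin d) ℝ
  W₁ : Matrix (Fin d) (Fin dff) ℝ
  b₁ : Fin dff → ℝ
  W₂ : Matrix (Fin dff) (Fin d) ℝ
  b₂ : Fin d → ℝ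
  gain₁ : Fin d → ℝ
  bias₁ : Fin d → ℝ
  gain₂ : Fin d → ℝ
  bias₂ : Fin d → ℝ

namespace TransformerLayer

variable {d H dk dv dff n : ℕ} (l : TransformerLayer d H dk dv dff)

/-- The head `h_j = Attention (Z W_j^Q, Z W_j^K, Z W_j^V)`. -/
def head (Z : Matrix (Fin n) (Fin d) ℝ) (j : Fin H) : Matrix (Fin n) (Fin dv) ℝ :=
  attention (Z * l.WQ j) (Z * l.WK j) (Z * l.WV j)

/-- `MultiHead Z = Concat (h_1, …, h_H) W^O`. -/
def multiHead (Z : Matrix (Fin n) (Fin d) ℝ) : Matrix (Fin n) (Fin d) ℝ :=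
  (Matrix.of fun (i : Fin n) (c : Fin H × Fin dv) => l.head Z c.1 i c.2) * l.WO

/-- The self-attention sublayer, `LayerNorm (Z + MultiHead Z)`. -/
def attnSublayer (η : ℝ) (Z : Matrix (Fin n) (Fin d) ℝ) : Matrix (Fin n) (Fin d) ℝ :=
  fun i => layerNorm η l.gain₁ l.bias₁ (Z i + l.multiHead Z i)

/-- The position-wise feedforward network `z ↦ ReLU (z W₁ + b₁) W₂ + b₂`. -/
def ffn (z : Fin d → ℝ) : Fin d → ℝ :=
  (fun k => max ((z ᵥ* l.W₁) k + l.b₁ k) 0) ᵥ* l.W₂ + l.b₂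

/-- The feedforward sublayer, `LayerNorm (z + FFN z)` at every position. -/
def ffnSublayer (η : ℝ) (Z : Matrix (Fin n) (Fin d) ℝ) : Matrix (Fin n) (Fin d) ℝ :=
  fun i => layerNorm η l.gain₂ l.bias₂ (Z i + l.ffn (Z i))

/-- The full update rule of a layer. -/
def apply (η : ℝ) (Z : Matrix (Fin n) (Fin d) ℝ) : Matrix (Fin n) (Fin d) ℝ :=
  l.ffnSublayer η (l.attnSublayer η Z)

end TransformerLayer

/-- The successive application of a list of layers, the first one first. -/
def runLayers {d H dk dv dff n : ℕ} (η : ℝ) (ls : List (TransformerLayer d H dk dv dff))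
    (Z : Matrix (Fin n) (Fin d) ℝ) : Matrix (Fin n) (Fin d) ℝ :=
  ls.foldl (fun Z l => l.apply η Z) Z

/-- A transformer acting on sequences of `n` scalar tokens: a linear embedding of the tokens into
`ℝ^d`, a positional encoding, a stack of layers, and an affine readout of one scalar at each
position. -/
structure Transformer (n : ℕ) where
  (d H dk dv dff : ℕ)
  embed : Fin d → ℝ
  pos : Fin n → Fin d → ℝ
  layers : List (TransformerLayer d H dk dv dff)
  readout : Fin d → ℝ
  readoutBias : ℝ

/-- A contextual mapping on a set `S` of sequences of `n` tokens: the `n` values on a sequence of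
`S` are distinct, and the values on two different sequences of `S` are all different. -/
def IsContextualMapping {n : ℕ} (S : Set (Fin n → ℝ)) (q : (Fin n → ℝ) → Fin n → ℝ) : Prop :=
  (∀ s ∈ S, Function.Injective (q s)) ∧
    ∀ s ∈ S, ∀ t ∈ S, s ≠ t → ∀ i j, q s i ≠ q t j

namespace Transformer

variable {n : ℕ} (W : Transformer n)

/-- The embedded sequence with the positional encoding added. -/
def input (s : Fin n → ℝ) : Matrix (Fin n) (Fin W.d) ℝ :=
  fun i => s i • W.embed + W.pos i

/-- The sequence-to-sequence function `ℝ^n → ℝ^n` computed by the transformer. -/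
def eval (η : ℝ) (s : Fin n → ℝ) : Fin n → ℝ :=
  fun i => runLayers η W.layers (W.input s) i ⬝ᵥ W.readout + W.readoutBias

/-- The self-attention of the transformer implements a contextual mapping on `S`: for one of its
layers, a linear functional of the tokens produced by the self-attention sublayer of this layer is
a contextual mapping on `S`. -/
def HasContextualMapping (η : ℝ) (S : Set (Fin n → ℝ)) : Prop :=
  ∃ (before : List (TransformerLayer W.d W.H W.dk W.dv W.dff))
    (l : TransformerLayer W.d W.H W.dk W.dv W.dff)
    (after : List (TransformerLayer W.d W.H W.dk W.dv W.dff)),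
    W.layers = before ++ l :: after ∧
    ∃ u : Fin W.d → ℝ,
      IsContextualMapping S
        (fun s i => l.attnSublayer η (runLayers η before (W.input s)) i ⬝ᵥ u)

end Transformer

/-! ### Leray-Schauder transformers -/

/-- The sequence of the `k` coordinates of `v` in the basis `b`, padded with zeros to the
length `n`. -/
def coordTokens {E : Type*} [AddCommGroup E] [Module ℝ E] {k : ℕ} (b : Module.Basis (Fin k) ℝ E)
    (n : ℕ) (v : E) : Fin n → ℝ :=
  fun i => if h : (i : ℕ) < k then b.repr v ⟨i, h⟩ else 0

/-- A Leray-Schauder transformer for a set `K ⊆ X` with values in `Y`: the Leray-Schauder mapping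
`P` of a finite `δ`-net of `K`, a basis of the span `E` of the net giving the coordinates of `P z`,
a transformer on sequences of `n ≥ 2` scalar tokens, where `n` is at least the dimension of `E`,
with a contextual mapping on the finite set of the sequences of coordinates of the points of the
net, and vectors of `Y` of which the scalars returned by the transformer are the coefficients.
The parameter `η` is the stabilizing constant of all layer normalizations. -/
structure LeraySchauderTransformer {X : Type*} [NormedAddCommGroup X] [NormedSpace ℝ X]
    (K : Set X) (Y : Type*) [NormedAddCommGroup Y] [NormedSpace ℝ Y] (η : ℝ) where
  δ : ℝ
  δ_pos : 0 < δ
  N : ℕ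
  net : Fin N → X
  isFiniteNet : IsFiniteNet K δ net
  k : ℕ
  basis : Module.Basis (Fin k) ℝ (Submodule.span ℝ (Set.range net))
  n : ℕ
  two_le_n : 2 ≤ n
  k_le_n : k ≤ n
  transformer : Transformer n
  contextual : transformer.HasContextualMapping η
    (Set.range fun i : Fin N =>
      coordTokens basis n ⟨net i, Submodule.subset_span (Set.mem_range_self i)⟩)
  outVec : Fin n → Y

/-- The operator `X → Y` given by a Leray-Schauder transformer. -/
def LeraySchauderTransformer.eval {X : Type*} [NormedAddCommGroup X] [NormedSpace ℝ X]
    {K : Set X} {Y : Type*} [NormedAddCommGroup Y] [NormedSpace ℝ Y] {η : ℝ}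
    (𝔗 : LeraySchauderTransformer K Y η) (z : X) : Y :=
  ∑ i, 𝔗.transformer.eval η (coordTokens 𝔗.basis 𝔗.n (lsMap 𝔗.δ 𝔗.net z)) i • 𝔗.outVec i

end

noncomputable section

/-! On `K` the Leray-Schauder mapping `P` moves points by at most `δ`, so by uniform continuity `T ∘
P` is within `ε / 2` of `T`. It remains to approximate `T` on a ball of the finite-dimensional space
`E`, and one transformer layer whose attention matrices do not depend on the input suffices.

The positional part of token `i` contains the unit vector `e_i`, so queries and keys reading only
that part realize any score matrix. Two heads and the residual connection then give every linear map
with row sums one (`exists_rowSoftmax_sub`), and two padding tokens turn these into arbitrary affine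
maps of the coordinates (`exists_matrix_coordTokens`). The feedforward network is zero: the
nonlinearity comes from the two layer normalizations, whose composition is, after rescaling, exactly
`lnSigmoid` (`exists_transformer_eval_eq_lnSigmoid`). The Leray-Schauder transformer is therefore a
one-hidden-layer network `∑ i, lnSigmoid (w i v + b i) • y i`.

Such sums are dense (`exists_mem_ridgeSpan_approx`): sigmoids approximate monotone functions of one
variable, hence the exponentials `exp (w v)`, to which Stone-Weierstrass applies; a partition of
unity on the range passes to values in `Y`. The first normalization is injective in the signal, so a
contextual mapping only requires all `w i v + b i` at the net points to be distinct, which a small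
perturbation achieves (`exists_sum_ridge_approx_injective`). -/

/-! ### The nonlinearity of layer normalization -/

/-- The sigmoidal function `u ↦ u / √(1 + u²)`. -/
def lnSigmoid (u : ℝ) : ℝ := u / Real.sqrt (1 + u ^ 2)

theorem continuous_lnSigmoid : Continuous lnSigmoid := by
  unfold lnSigmoid
  refine continuous_id.div (by fun_prop) fun u => ?_
  positivity

theorem lnSigmoid_eq_sin_arctan (u : ℝ) : lnSigmoid u = Real.sin (Real.arctan u) :=
  (Real.sin_arctan u).symm

theorem abs_lnSigmoid_le_one (u : ℝ) : |lnSigmoid u| ≤ 1 := by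
  rw [lnSigmoid_eq_sin_arctan]
  exact Real.abs_sin_le_one _

theorem lnSigmoid_neg (u : ℝ) : lnSigmoid (-u) = -lnSigmoid u := by
  simp [lnSigmoid, neg_div]

theorem tendsto_lnSigmoid_atTop : Filter.Tendsto lnSigmoid Filter.atTop (nhds 1) := by
  have h : lnSigmoid = fun u => Real.sin (Real.arctan u) := funext lnSigmoid_eq_sin_arctan
  rw [h, ← Real.sin_pi_div_two]
  exact (Real.continuous_sin.tendsto _).comp
    (Real.tendsto_arctan_atTop.mono_right nhdsWithin_le_nhds)

/-- Squaring and clearing denominators leaves `α * x ^ 2 = α * y ^ 2`, so the two denominators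
agree. This is the profile of the first layer normalization; distinct signals stay distinct after
it. -/
theorem div_sqrt_add_mul_sq_injective {α β : ℝ} (hα : 0 < α) (hβ : 0 ≤ β) :
    Function.Injective fun x : ℝ => x / Real.sqrt (α + β * x ^ 2) := by
  intro x y h
  have hx : 0 < α + β * x ^ 2 := by positivity
  have hy : 0 < α + β * y ^ 2 := by positivity
  have hsq : x ^ 2 = y ^ 2 := by
    have h2 : (x / Real.sqrt (α + β * x ^ 2)) ^ 2 = (y / Real.sqrt (α + β * y ^ 2)) ^ 2 := by
      rw [show x / Real.sqrt (α + β * x ^ 2) = y / Real.sqrt (α + β * y ^ 2) from h]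
    rw [div_pow, div_pow, Real.sq_sqrt hx.le, Real.sq_sqrt hy.le,
      div_eq_div_iff hx.ne' hy.ne'] at h2
    have h3 : α * (x ^ 2 - y ^ 2) = 0 := by linarith
    rcases mul_eq_zero.1 h3 with h4 | h4
    · exact absurd h4 hα.ne'
    · linarith
  have h' : x / Real.sqrt (α + β * x ^ 2) = y / Real.sqrt (α + β * y ^ 2) := h
  rw [hsq] at h'
  exact (div_left_inj' (Real.sqrt_pos.2 hy).ne').1 h'

/-! ### Transformers computing sigmoids of affine maps -/

/-- A matrix with vanishing row sums is a multiple of the difference of two attention matrices. -/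
theorem exists_rowSoftmax_sub {n : ℕ} (M : Matrix (Fin n) (Fin n) ℝ) (hM : ∀ i, ∑ j, M i j = 0) :
    ∃ (B : Matrix (Fin n) (Fin n) ℝ) (c : ℝ),
      ∀ i j, c * rowSoftmax B i j - c * rowSoftmax 0 i j = M i j := by
  set C : ℝ := ∑ i, ∑ j, |M i j| with hC
  have hCle : ∀ i j, |M i j| ≤ C := fun i j =>
    (Finset.single_le_sum (f := fun j => |M i j|) (fun _ _ => abs_nonneg _)
      (Finset.mem_univ j)).trans
    (Finset.single_le_sum (f := fun i => ∑ j, |M i j|)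
      (fun _ _ => Finset.sum_nonneg fun _ _ => abs_nonneg _) (Finset.mem_univ i))
  have hC0 : 0 ≤ C := Finset.sum_nonneg fun _ _ => Finset.sum_nonneg fun _ _ => abs_nonneg _
  have hpos : ∀ i j, 0 < 1 + M i j / (C + 1) := by
    intro i j
    have h1 : -C ≤ M i j := (abs_le.1 (hCle i j)).1
    have h2 : -1 < M i j / (C + 1) := by
      rw [lt_div_iff₀ (by linarith)]
      linarith
    linarith
  -- The exponentials of these scores are `1 + M i j / (C + 1)`, positive because `C` bounds the
  -- entries. Their row sums are `n` since those of `M` vanish, so the softmax differs from the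
  -- uniform `1 / n` by `M i j / (n * (C + 1))`.
  refine ⟨fun i j => Real.log (1 + M i j / (C + 1)), n * (C + 1), fun i j => ?_⟩
  have hn : (n : ℝ) ≠ 0 := by
    have := i.pos
    positivity
  have hC1 : C + 1 ≠ 0 := by positivity
  simp only [rowSoftmax, Real.exp_log (hpos _ _), Matrix.zero_apply, Real.exp_zero,
    Finset.sum_add_distrib, ← Finset.sum_div, hM]
  simp
  field_simp
  ring

section TransformerConstruction

variable {n : ℕ}

/-- The vector `v` preceded by the three entries `a`, `b`, `c`. -/
def cons₃ {α : Type*} (a b c : α) (v : Fin n → α) : Fin (n + 3) → α :=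
  Fin.cons a (Fin.cons b (Fin.cons c v))

section cons₃

variable {α : Type*} (a b c : α) (v : Fin n → α)

@[simp] theorem cons₃_zero : cons₃ a b c v 0 = a := rfl

@[simp] theorem cons₃_one : cons₃ a b c v 1 = b := rfl

@[simp] theorem cons₃_two : cons₃ a b c v 2 = c := rfl

@[simp] theorem cons₃_succ_succ_succ (i : Fin n) : cons₃ a b c v i.succ.succ.succ = v i := rfl

theorem forall_fin_add_three {p : Fin (n + 3) → Prop} (h0 : p 0) (h1 : p 1) (h2 : p 2)
    (h : ∀ i : Fin n, p i.succ.succ.succ) (l : Fin (n + 3)) :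
    p l :=
  Fin.cases h0 (fun l => Fin.cases h1 (fun l => Fin.cases h2 h l) l) l

theorem sum_fin_add_three (f : Fin (n + 3) → ℝ) :
    ∑ l, f l = f 0 + f 1 + f 2 + ∑ i : Fin n, f i.succ.succ.succ := by
  rw [Fin.sum_univ_succ, Fin.sum_univ_succ, Fin.sum_univ_succ, ← add_assoc, ← add_assoc]
  rfl

end cons₃

/-- The matrix `A` preceded by the three rows `a`, `b`, `c`. -/
def rows₃ {m : ℕ} (a b c : Fin m → ℝ) (A : Matrix (Fin n) (Fin m) ℝ) :
    Matrix (Fin (n + 3)) (Fin m) ℝ :=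
  cons₃ a b c A

/-- The direction `(1, -1, 0, …, 0)`, the coordinates of which have mean zero. -/
def signalDir (n : ℕ) : Fin (n + 3) → ℝ := cons₃ 1 (-1) 0 0

/-- The sequence of the tokens `(x_i, -x_i, -1, e_i)` of width `n + 3`. -/
def posTokens (x : Fin n → ℝ) : Matrix (Fin n) (Fin (n + 3)) ℝ :=
  fun i => cons₃ (x i) (-x i) (-1) (Pi.single i 1)

/-- The layer with two heads whose attention matrices are `rowSoftmax B` and `rowSoftmax 0`,
computing `c` times the difference of the two averages of the leading coordinates. -/
def twoHeadLayer (B : Matrix (Fin n) (Fin n) ℝ) (c : ℝ) : TransformerLayer (n + 3) 2 n 1 1 where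
  WQ _ := rows₃ 0 0 0 (1 : Matrix (Fin n) (Fin n) ℝ)
  WK := ![rows₃ 0 0 0 (Real.sqrt n • Bᵀ), 0]
  WV _ := rows₃ 1 0 0 0
  WO h := (![c, -c] h.1) • signalDir n
  W₁ := 0
  b₁ := 0
  W₂ := 0
  b₂ := 0
  gain₁ := cons₃ 1 1 0 0
  bias₁ := 0
  gain₂ := 1
  bias₂ := 0

theorem posTokens_mul_apply {m : ℕ} (x : Fin n → ℝ) (r₀ r₁ r₂ : Fin m → ℝ)
    (A : Matrix (Fin n) (Fin m) ℝ) (i : Fin n) (j : Fin m) :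
    (posTokens x * rows₃ r₀ r₁ r₂ A) i j =
      x i * r₀ j - x i * r₁ j - r₂ j + A i j := by
  rw [Matrix.mul_apply, sum_fin_add_three]
  change x i * r₀ j + -x i * r₁ j + -1 * r₂ j + ∑ k, (Pi.single i 1 : Fin n → ℝ) k * A k j = _
  simp only [Pi.single_apply, ite_mul, one_mul, zero_mul, Finset.sum_ite_eq',
    Finset.mem_univ, if_true]
  ring

theorem posTokens_mul_WV (B : Matrix (Fin n) (Fin n) ℝ) (c : ℝ) (x : Fin n → ℝ) (h : Fin 2)
    (i : Fin n) (j : Fin 1) : (posTokens x * (twoHeadLayer B c).WV h) i j = x i := by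
  change (posTokens x * rows₃ (1 : Fin 1 → ℝ) 0 0 0 : Matrix (Fin n) (Fin 1) ℝ) i j = x i
  rw [posTokens_mul_apply]
  simp

/-- The query of token `i` is `e_i` and the key of token `j` is column `j` of `√n B`, so the scores
are `B` whatever the signal `x` is; the factor `√n` cancels the scaling by the key dimension. -/
theorem twoHeadLayer_head_zero (B : Matrix (Fin n) (Fin n) ℝ) (c : ℝ) (x : Fin n → ℝ) (i : Fin n) :
    (twoHeadLayer B c).head (posTokens x) 0 i 0 = ∑ j, rowSoftmax B i j * x j := by
  have hn : (Real.sqrt n)⁻¹ * Real.sqrt n = 1 := by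
    have := i.pos
    exact inv_mul_cancel₀ (by positivity)
  have hK : (twoHeadLayer B c).WK 0 = rows₃ 0 0 0 (Real.sqrt n • Bᵀ) := rfl
  have hQ : (twoHeadLayer B c).WQ 0 = rows₃ 0 0 0 (1 : Matrix (Fin n) (Fin n) ℝ) := rfl
  have hS : (Real.sqrt n)⁻¹ • ((posTokens x * (twoHeadLayer B c).WQ 0) *
      (posTokens x * (twoHeadLayer B c).WK 0)ᵀ) = B := by
    ext i j
    rw [Matrix.smul_apply, Matrix.mul_apply, hK, hQ]
    simp only [Matrix.transpose_apply, posTokens_mul_apply]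
    simp [Matrix.one_apply, ← mul_assoc, hn]
  change (rowSoftmax _ * _ : Matrix (Fin n) (Fin 1) ℝ) i 0 = _
  rw [hS, Matrix.mul_apply]
  simp only [posTokens_mul_WV]

theorem twoHeadLayer_head_one (B : Matrix (Fin n) (Fin n) ℝ) (c : ℝ) (x : Fin n → ℝ) (i : Fin n) :
    (twoHeadLayer B c).head (posTokens x) 1 i 0 = ∑ j, rowSoftmax 0 i j * x j := by
  have hK : (twoHeadLayer B c).WK 1 = 0 := rfl
  change (rowSoftmax _ * _ : Matrix (Fin n) (Fin 1) ℝ) i 0 = _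
  rw [hK, Matrix.mul_zero, Matrix.transpose_zero, Matrix.mul_zero, smul_zero, Matrix.mul_apply]
  simp only [posTokens_mul_WV]

/-- The matrix of the map computed by `twoHeadLayer B c`, before the layer normalization. -/
def twoHeadMatrix (B : Matrix (Fin n) (Fin n) ℝ) (c : ℝ) : Matrix (Fin n) (Fin n) ℝ :=
  1 + (c • rowSoftmax B - c • rowSoftmax 0)

/-- The heads write only along `signalDir`, so the residual sum is again of the form `posTokens` and
attention acts linearly on the signal. -/
theorem twoHeadLayer_residual (B : Matrix (Fin n) (Fin n) ℝ) (c : ℝ) (x : Fin n → ℝ) (i : Fin n) :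
    posTokens x i + (twoHeadLayer B c).multiHead (posTokens x) i =
      posTokens (twoHeadMatrix B c *ᵥ x) i := by
  have hm : (twoHeadLayer B c).multiHead (posTokens x) i =
      (c * ∑ j, rowSoftmax B i j * x j - c * ∑ j, rowSoftmax 0 i j * x j) • signalDir n := by
    ext l
    simp only [TransformerLayer.multiHead, Matrix.mul_apply, Matrix.of_apply,
      Fintype.sum_prod_type, Fin.sum_univ_two, Finset.univ_unique, Finset.sum_singleton,
      Fin.default_eq_zero, twoHeadLayer_head_zero, twoHeadLayer_head_one]
    simp only [twoHeadLayer, Pi.smul_apply, smul_eq_mul, Matrix.cons_val_zero, Matrix.cons_val_one]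
    ring
  have hx : (twoHeadMatrix B c *ᵥ x) i =
      x i + (c * ∑ j, rowSoftmax B i j * x j - c * ∑ j, rowSoftmax 0 i j * x j) := by
    rw [twoHeadMatrix, Matrix.add_mulVec, Matrix.one_mulVec, Matrix.sub_mulVec,
      Matrix.smul_mulVec, Matrix.smul_mulVec]
    rfl
  rw [hm]
  ext l
  revert l
  refine forall_fin_add_three ?_ ?_ ?_ fun l => ?_
  · simp [posTokens, signalDir, hx]
  · simp [posTokens, signalDir, hx]
    ring
  · simp [posTokens, signalDir]
  · simp [posTokens, signalDir]

/-- The entry `-x_i` balances `x_i`, and `-1` balances the one in `e_i`: centring has no effect. -/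
theorem vecMean_posTokens (x : Fin n → ℝ) (i : Fin n) : vecMean (posTokens x i) = 0 := by
  rw [vecMean, sum_fin_add_three]
  simp [posTokens]

theorem vecVar_posTokens (x : Fin n → ℝ) (i : Fin n) :
    vecVar (posTokens x i) = (2 * x i ^ 2 + 2) / (n + 3) := by
  rw [vecVar, vecMean_posTokens, sum_fin_add_three]
  simp [posTokens, Pi.single_apply]
  ring

/-- The positional part contributes the constant `2 / (n + 3)` to the variance at every position;
the gain then erases it, leaving a multiple of `signalDir`. -/
theorem twoHeadLayer_attnSublayer (η : ℝ) (B : Matrix (Fin n) (Fin n) ℝ) (c : ℝ)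
    (x : Fin n → ℝ) :
    (twoHeadLayer B c).attnSublayer η (posTokens x) = fun i =>
      ((twoHeadMatrix B c *ᵥ x) i / Real.sqrt ((2 / (n + 3) + η) + 2 / (n + 3) *
        (twoHeadMatrix B c *ᵥ x) i ^ 2)) • signalDir n := by
  funext i
  change layerNorm η _ _ (posTokens x i + (twoHeadLayer B c).multiHead (posTokens x) i) = _
  rw [twoHeadLayer_residual]
  generalize twoHeadMatrix B c *ᵥ x = y
  have hv : (2 * y i ^ 2 + 2) / ((n : ℝ) + 3) + η =
      (2 / (n + 3) + η) + 2 / (n + 3) * y i ^ 2 := by ring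
  ext l
  rw [layerNorm, vecMean_posTokens, vecVar_posTokens, hv]
  revert l
  refine forall_fin_add_three ?_ ?_ ?_ fun l => ?_
  · simp [twoHeadLayer, posTokens, signalDir]
  · simp [twoHeadLayer, posTokens, signalDir, neg_div]
  · simp [twoHeadLayer, signalDir]
  · simp [twoHeadLayer, signalDir]

theorem twoHeadLayer_ffnSublayer (η : ℝ) (B : Matrix (Fin n) (Fin n) ℝ) (c : ℝ)
    (y : Fin n → ℝ) (i : Fin n) :
    (twoHeadLayer B c).ffnSublayer η (fun i => y i • signalDir n) i 0 =
      y i / Real.sqrt (η + 2 / (n + 3) * y i ^ 2) := by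
  have hf : (twoHeadLayer B c).ffn (y i • signalDir n) = 0 := by
    simp [TransformerLayer.ffn, twoHeadLayer]
  have hm : vecMean (y i • signalDir n) = 0 := by
    rw [vecMean, sum_fin_add_three]
    simp [signalDir]
  have hv : vecVar (y i • signalDir n) = 2 / (n + 3) * y i ^ 2 := by
    rw [vecVar, hm, sum_fin_add_three]
    simp [signalDir]
    ring
  change layerNorm η _ _ (y i • signalDir n + (twoHeadLayer B c).ffn (y i • signalDir n)) 0 = _
  rw [hf, add_zero, layerNorm, hm, hv, add_comm η]
  simp [twoHeadLayer, signalDir]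

/-- Every affine map `s ↦ G (s + b)` with the row sums of `G` equal to one, followed by
`lnSigmoid` in each coordinate, is computed by a transformer with one layer, the self-attention of
which is a contextual mapping wherever the affine map is. -/
theorem exists_transformer_eval_eq_lnSigmoid {η : ℝ} (hη : 0 < η) (G : Matrix (Fin n) (Fin n) ℝ)
    (hG : ∀ i, ∑ j, G i j = 1) (b : Fin n → ℝ) :
    ∃ W : Transformer n, (∀ s i, W.eval η s i = lnSigmoid ((G *ᵥ (s + b)) i)) ∧
      ∀ S, IsContextualMapping S (fun s => G *ᵥ (s + b)) → W.HasContextualMapping η S := by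
  obtain ⟨B, c, hBc⟩ := exists_rowSoftmax_sub (G - 1) (by
    intro i
    simp [Finset.sum_sub_distrib, hG, Matrix.one_apply])
  have hGB : twoHeadMatrix B c = G := by
    rw [twoHeadMatrix, show c • rowSoftmax B - c • rowSoftmax 0 = G - 1 from
      Matrix.ext fun i j => hBc i j, add_sub_cancel]
  set α : ℝ := 2 / (n + 3) + η with hα
  set β : ℝ := 2 / (n + 3) with hβ
  have hβ0 : 0 < β := by positivity
  have hα0 : 0 < α := by positivity
  set γ : ℝ := β * (1 + η) with hγ
  have hγ0 : 0 < γ := by positivity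
  -- Composing both normalizations on `r * u` gives `r * u / √(η * α + γ * r ^ 2 * u ^ 2)`. This `r`
  -- makes the two coefficients equal, so the result is `lnSigmoid u / √γ`, and the readout
  -- multiplies by `√γ`.
  set r : ℝ := Real.sqrt (η * α / γ) with hr
  have hr0 : 0 < r := Real.sqrt_pos.2 (by positivity)
  have hr2 : γ * r ^ 2 = η * α := by
    rw [hr, Real.sq_sqrt (by positivity)]
    field_simp
  let W : Transformer n :=
    { d := n + 3, H := 2, dk := n, dv := 1, dff := 1
      embed := r • signalDir n
      pos := posTokens (r • b)
      layers := [twoHeadLayer B c]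
      readout := cons₃ (Real.sqrt γ) 0 0 0
      readoutBias := 0 }
  have hin : ∀ s, W.input s = posTokens (r • (s + b)) := by
    intro s
    ext i l
    change s i * (r * signalDir n l) + posTokens (r • b) i l = _
    revert l
    refine forall_fin_add_three ?_ ?_ ?_ fun l => ?_
    · simp [posTokens, signalDir]
      ring
    · simp [posTokens, signalDir]
      ring
    · simp [posTokens, signalDir]
    · simp [posTokens, signalDir]
  have hattn : ∀ s, (twoHeadLayer B c).attnSublayer η (W.input s) =
      fun i => ((r * (G *ᵥ (s + b)) i) / Real.sqrt (α + β * (r * (G *ᵥ (s + b)) i) ^ 2)) •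
        signalDir n := by
    intro s
    rw [hin, twoHeadLayer_attnSublayer, hGB, Matrix.mulVec_smul]
    rfl
  refine ⟨W, fun s i => ?_, fun S hS => ⟨[], twoHeadLayer B c, [], rfl, cons₃ 1 0 0 0, ?_⟩⟩
  · have h1 : W.eval η s i = (twoHeadLayer B c).ffnSublayer η
        ((twoHeadLayer B c).attnSublayer η (W.input s)) i 0 * Real.sqrt γ := by
      change ∑ l, (twoHeadLayer B c).ffnSublayer η
        ((twoHeadLayer B c).attnSublayer η (W.input s)) i l * cons₃ (Real.sqrt γ) 0 0 0 l + 0 = _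
      rw [sum_fin_add_three]
      simp
    rw [h1, hattn, twoHeadLayer_ffnSublayer]
    generalize (G *ᵥ (s + b)) i = u
    have hq : 0 < α + β * (r * u) ^ 2 := by positivity
    have h2 : η + 2 / ((n : ℝ) + 3) * (r * u / Real.sqrt (α + β * (r * u) ^ 2)) ^ 2 =
        (γ * r ^ 2) * (1 + u ^ 2) / (α + β * (r * u) ^ 2) := by
      rw [← hβ, div_pow, Real.sq_sqrt hq.le, eq_div_iff hq.ne', add_mul, mul_assoc β,
        div_mul_cancel₀ _ hq.ne', mul_add (γ * r ^ 2), mul_one, hr2, ← hr2, hγ]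
      linear_combination -(hr2)
    rw [h2, Real.sqrt_div (by positivity), Real.sqrt_mul (by positivity),
      Real.sqrt_mul hγ0.le, Real.sqrt_sq hr0.le, lnSigmoid]
    have h3 := Real.sqrt_pos.2 hq
    have h4 := Real.sqrt_pos.2 hγ0
    have h5 : 0 < Real.sqrt (1 + u ^ 2) := by positivity
    field_simp
  · have hu : ∀ s i, (twoHeadLayer B c).attnSublayer η (W.input s) i ⬝ᵥ cons₃ 1 0 0 0 =
        (fun x : ℝ => x / Real.sqrt (α + β * x ^ 2)) (r * (G *ᵥ (s + b)) i) := by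
      intro s i
      rw [hattn, dotProduct, sum_fin_add_three]
      simp [signalDir]
    have hinj : ∀ s t i j, (twoHeadLayer B c).attnSublayer η (W.input s) i ⬝ᵥ cons₃ 1 0 0 0 =
        (twoHeadLayer B c).attnSublayer η (W.input t) j ⬝ᵥ cons₃ 1 0 0 0 →
        (G *ᵥ (s + b)) i = (G *ᵥ (t + b)) j := by
      intro s t i j h
      rw [hu, hu] at h
      exact mul_left_cancel₀ hr0.ne' (div_sqrt_add_mul_sq_injective hα0 hβ0.le h)
    exact ⟨fun s hs i j h => hS.1 s hs (hinj s s i j h),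
      fun s hs t ht hst i j h => hS.2 s hs t ht hst i j (hinj s t i j h)⟩

end TransformerConstruction

/-! ### The Leray-Schauder mapping is close to the identity -/

section LeraySchauderEstimates

variable {X : Type*} [NormedAddCommGroup X]

theorem lsWeight_eq_max (δ : ℝ) {N : ℕ} (x : Fin N → X) (i : Fin N) (z : X) :
    lsWeight δ x i z = max (δ - ‖z - x i‖) 0 := by
  rw [lsWeight]
  split_ifs with h
  · rw [max_eq_left (sub_nonneg.2 h)]
  · rw [max_eq_right (sub_nonpos.2 (not_le.1 h).le)]

theorem lsWeight_nonneg (δ : ℝ) {N : ℕ} (x : Fin N → X) (i : Fin N) (z : X) :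
    0 ≤ lsWeight δ x i z := by
  rw [lsWeight_eq_max]
  exact le_max_right _ _

theorem continuous_lsWeight (δ : ℝ) {N : ℕ} (x : Fin N → X) (i : Fin N) :
    Continuous (lsWeight δ x i) := by
  have h : lsWeight δ x i = fun z => max (δ - ‖z - x i‖) 0 := funext (lsWeight_eq_max δ x i)
  rw [h]
  fun_prop

theorem sum_lsWeight_pos {δ : ℝ} {N : ℕ} {x : Fin N → X} {z : X} (h : ∃ i, ‖z - x i‖ < δ) :
    0 < ∑ i, lsWeight δ x i z := by
  obtain ⟨i, hi⟩ := h
  refine Finset.sum_pos' (fun i _ => lsWeight_nonneg δ x i z) ⟨i, Finset.mem_univ i, ?_⟩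
  rw [lsWeight_eq_max]
  exact lt_max_of_lt_left (sub_pos.2 hi)

theorem IsCompact.exists_isFiniteNet {K : Set X} (hK : IsCompact K) {δ : ℝ} (hδ : 0 < δ) :
    ∃ (N : ℕ) (x : Fin N → X), IsFiniteNet K δ x := by
  obtain ⟨t, htK, htf, hcov⟩ := hK.finite_cover_balls hδ
  obtain ⟨N, x, -, rfl⟩ := htf.fin_param
  refine ⟨N, x, fun i => htK (Set.mem_range_self i), fun z hz => ?_⟩
  obtain ⟨i, hi⟩ : ∃ i, dist z (x i) < δ := by simpa using hcov hz
  exact ⟨i, by rwa [← dist_eq_norm]⟩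

variable [NormedSpace ℝ X]

theorem coe_lsMap (δ : ℝ) {N : ℕ} (x : Fin N → X) (z : X) :
    (lsMap δ x z : X) = ∑ i, ((∑ i, lsWeight δ x i z)⁻¹ * lsWeight δ x i z) • x i := by
  simp [lsMap, Finset.smul_sum, mul_smul]

/-- The difference is a convex combination of the `z - x i`, in which only those of norm at most `δ`
have nonzero weight. -/
theorem norm_sub_lsMap_le {δ : ℝ} {N : ℕ} {x : Fin N → X} {z : X} (h : ∃ i, ‖z - x i‖ < δ) :
    ‖z - lsMap δ x z‖ ≤ δ := by
  have hpos := sum_lsWeight_pos h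
  have hone : ∑ i, (∑ i, lsWeight δ x i z)⁻¹ * lsWeight δ x i z = 1 := by
    rw [← Finset.mul_sum, inv_mul_cancel₀ hpos.ne']
  have hz : z - lsMap δ x z =
      ∑ i, ((∑ i, lsWeight δ x i z)⁻¹ * lsWeight δ x i z) • (z - x i) := by
    simp only [smul_sub, Finset.sum_sub_distrib, ← coe_lsMap, ← Finset.sum_smul, hone, one_smul]
  calc ‖z - lsMap δ x z‖
      ≤ ∑ i, ((∑ i, lsWeight δ x i z)⁻¹ * lsWeight δ x i z) * δ := by
        rw [hz]
        refine norm_sum_le_of_le _ fun i _ => ?_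
        rw [norm_smul, Real.norm_of_nonneg
          (mul_nonneg (inv_nonneg.2 hpos.le) (lsWeight_nonneg δ x i z)), mul_assoc, mul_assoc]
        refine mul_le_mul_of_nonneg_left ?_ (inv_nonneg.2 hpos.le)
        rw [lsWeight]
        split_ifs with hi
        · exact mul_le_mul_of_nonneg_left hi (sub_nonneg.2 hi)
        · simp
    _ = δ := by rw [← Finset.sum_mul, hone, one_mul]

end LeraySchauderEstimates

/-! ### Approximation of monotone functions of one variable -/

/-- Far from the origin, `(1 + lnSigmoid u) / 2` is close to the step function. -/
theorem exists_lnSigmoid_close {κ : ℝ} (hκ : 0 < κ) : ∃ L : ℝ, 0 ≤ L ∧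
    ∀ u, L ≤ u → 1 - κ ≤ (1 + lnSigmoid u) / 2 ∧ (1 + lnSigmoid (-u)) / 2 ≤ κ := by
  have h : ∀ᶠ u in Filter.atTop, 1 - κ < lnSigmoid u :=
    tendsto_lnSigmoid_atTop.eventually (lt_mem_nhds (by linarith))
  obtain ⟨L, hL⟩ := Filter.eventually_atTop.1 h
  refine ⟨max L 0, le_max_right _ _, fun u hu => ?_⟩
  have h1 := hL u ((le_max_left _ _).trans hu)
  rw [lnSigmoid_neg]
  constructor <;> linarith

theorem half_one_add_lnSigmoid_mem (u : ℝ) :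
    0 ≤ (1 + lnSigmoid u) / 2 ∧ (1 + lnSigmoid u) / 2 ≤ 1 := by
  have := abs_le.1 (abs_lnSigmoid_le_one u)
  constructor <;> linarith [this.1, this.2]

/-- Bounds, independently of the mesh, the number of sigmoids in transition at a given point. -/
theorem card_filter_abs_sub_lt_one_le (M : ℕ) {y : ℝ} (hy : 0 ≤ y) :
    ((Finset.range M).filter fun j : ℕ => |y - j| < 1).card ≤ 2 := by
  have : ((Finset.range M).filter fun j : ℕ => |y - j| < 1) ⊆ {⌊y⌋₊, ⌊y⌋₊ + 1} := by
    intro j hj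
    have h := abs_lt.1 (Finset.mem_filter.1 hj).2
    have h1 := Nat.floor_le hy
    have h2 := Nat.lt_floor_add_one y
    have h3 : j < ⌊y⌋₊ + 2 := by
      have : (j : ℝ) < ((⌊y⌋₊ + 2 : ℕ) : ℝ) := by
        push_cast
        linarith [h.1]
      exact_mod_cast this
    have h4 : ⌊y⌋₊ < j + 1 := by
      have : (⌊y⌋₊ : ℝ) < ((j + 1 : ℕ) : ℝ) := by
        push_cast
        linarith [h.2]
      exact_mod_cast this
    simp only [Finset.mem_insert, Finset.mem_singleton]
    omega
  exact (Finset.card_le_card this).trans Finset.card_le_two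

/-- A monotone continuous function is a uniform limit on `[-R, R]` of combinations of constants and
translates of dilations of `lnSigmoid`. -/
theorem exists_sum_lnSigmoid_approx {h : ℝ → ℝ} (hc : Continuous h) (hm : Monotone h) {R : ℝ}
    (hR : 0 < R) {ε : ℝ} (hε : 0 < ε) :
    ∃ (M : ℕ) (l : ℝ) (t Δ : ℕ → ℝ), ∀ x ∈ Set.Icc (-R) R,
      |h x - (h (-R) + ∑ j ∈ Finset.range M,
        Δ j * ((1 + lnSigmoid (l * (x - t j))) / 2))| < ε := by
  -- Error budget: at most two sigmoids in transition cost `ε / 4` each, and the tails of all others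
  -- cost `D * κ ≤ ε / 4` together.
  have huc := isCompact_Icc (a := -R) (b := R) |>.uniformContinuousOn_of_continuous hc.continuousOn
  obtain ⟨ρ₀, hρ₀, hρ₀'⟩ := Metric.uniformContinuousOn_iff.1 huc (ε / 4) (by positivity)
  obtain ⟨M, hM⟩ := exists_nat_gt (2 * R / ρ₀)
  have hM0 : (0 : ℝ) < M := (by positivity : 0 ≤ 2 * R / ρ₀).trans_lt hM
  set ρ : ℝ := 2 * R / M with hρ
  have hρpos : 0 < ρ := by positivity
  have hρlt : ρ < ρ₀ := by
    rw [hρ, div_lt_iff₀ hM0]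
    rw [div_lt_iff₀ hρ₀] at hM
    linarith
  have hMρ : M * ρ = 2 * R := by
    rw [hρ]
    field_simp
  set t : ℕ → ℝ := fun j => -R + j * ρ with ht
  have ht0 : t 0 = -R := by simp [ht]
  have htM : t M = R := by
    simp only [ht, hMρ]
    ring
  have hts : ∀ j, t (j + 1) = t j + ρ := fun j => by
    simp only [ht]
    push_cast
    ring
  have htmem : ∀ j ≤ M, t j ∈ Set.Icc (-R) R := by
    intro j hj
    have h1 : (j : ℝ) * ρ ≤ M * ρ := by
      have : (j : ℝ) ≤ M := by exact_mod_cast hj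
      gcongr
    have h2 : 0 ≤ (j : ℝ) * ρ := by positivity
    constructor <;> simp only [ht] <;> linarith
  set Δ : ℕ → ℝ := fun j => h (t (j + 1)) - h (t j) with hΔ
  have hΔ0 : ∀ j, 0 ≤ Δ j := fun j => sub_nonneg.2 (hm (by rw [hts]; linarith))
  have hΔlt : ∀ j < M, Δ j < ε / 4 := by
    intro j hj
    have := hρ₀' (t (j + 1)) (htmem _ hj) (t j) (htmem _ hj.le) (by
      rw [hts, Real.dist_eq, add_sub_cancel_left, abs_of_pos hρpos]
      exact hρlt)
    exact (le_abs_self _).trans_lt (by rwa [Real.dist_eq] at this)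
  set D : ℝ := h R - h (-R) with hD
  have hD0 : 0 ≤ D := sub_nonneg.2 (hm (by linarith))
  have hΔsum : ∑ j ∈ Finset.range M, Δ j = D := by
    rw [Finset.sum_range_sub (fun j => h (t j)), htM, ht0]
  set κ : ℝ := ε / (4 * (D + 1)) with hκ
  have hκ0 : 0 < κ := by positivity
  have hκD : D * κ ≤ ε / 4 := by
    rw [hκ, ← mul_div_assoc, div_le_div_iff₀ (by positivity) (by positivity)]
    nlinarith
  obtain ⟨L, hL0, hL⟩ := exists_lnSigmoid_close hκ0
  -- With slope `L / ρ`, one mesh width away from `t j` the argument already has modulus at least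
  -- `L`.
  refine ⟨M, L / ρ, t, Δ, fun x hx => ?_⟩
  -- Truncating at `x` gives a sum indexed like the sigmoids: its terms are `Δ j` to the left of `x`
  -- and `0` to the right, and lie in `[0, Δ j]` in between.
  have htel : h x - h (-R) = ∑ j ∈ Finset.range M, (h (min x (t (j + 1))) - h (min x (t j))) := by
    rw [Finset.sum_range_sub (fun j => h (min x (t j))), htM, ht0, min_eq_left hx.2,
      min_eq_right hx.1]
  rw [← sub_sub, htel, ← Finset.sum_sub_distrib]
  set y : ℝ := (x + R) / ρ with hy
  have hy0 : 0 ≤ y := div_nonneg (by linarith [hx.1]) hρpos.le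
  have hyt : ∀ j : ℕ, x - t j = ρ * (y - j) := by
    intro j
    rw [hy, mul_sub, mul_div_cancel₀ _ hρpos.ne']
    simp only [ht]
    ring
  have hlin : ∀ j : ℕ, L / ρ * (x - t j) = L * (y - j) := by
    intro j
    rw [hyt]
    field_simp
  have hterm : ∀ j ∈ Finset.range M, |h (min x (t (j + 1))) - h (min x (t j)) -
      Δ j * ((1 + lnSigmoid (L / ρ * (x - t j))) / 2)| ≤
      Δ j * κ + if |y - j| < 1 then ε / 4 else 0 := by
    intro j hj
    have hj' := Finset.mem_range.1 hj
    obtain ⟨hs0, hs1⟩ := half_one_add_lnSigmoid_mem (L / ρ * (x - t j))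
    rw [hlin] at hs0 hs1 ⊢
    set s := (1 + lnSigmoid (L * (y - j))) / 2 with hs
    have hΔj := hΔ0 j
    split_ifs with hyj
    · have h1 : 0 ≤ h (min x (t (j + 1))) - h (min x (t j)) :=
        sub_nonneg.2 (hm (min_le_min_left _ (by rw [hts]; linarith)))
      have h2 : h (min x (t (j + 1))) - h (min x (t j)) ≤ Δ j := by
        rcases le_total x (t j) with hxt | hxt
        · rw [min_eq_left hxt, min_eq_left (hxt.trans (by rw [hts]; linarith)), sub_self]
          exact hΔj
        · rw [min_eq_right hxt]
          exact sub_le_sub_right (hm (min_le_right _ _)) _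
      have h3 := hΔlt j hj'
      have h4 : Δ j * s ≤ Δ j := mul_le_of_le_one_right hΔj hs1
      have h5 : 0 ≤ Δ j * s := mul_nonneg hΔj hs0
      have h6 : 0 ≤ Δ j * κ := mul_nonneg hΔj hκ0.le
      rw [abs_le]
      constructor <;> linarith
    · rw [add_zero]
      rcases le_abs.1 (not_lt.1 hyj) with h1 | h1
      · have hx1 : t (j + 1) ≤ x := by
          have := hyt j
          rw [hts]
          nlinarith
        have hx0 : t j ≤ x := by
          rw [hts] at hx1
          linarith
        have h2 := (hL (L * (y - j)) (le_mul_of_one_le_right hL0 h1)).1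
        rw [min_eq_right hx1, min_eq_right hx0, show h (t (j + 1)) - h (t j) - Δ j * s =
          Δ j * (1 - s) by simp only [hΔ]; ring, abs_of_nonneg (mul_nonneg hΔj (by linarith))]
        exact mul_le_mul_of_nonneg_left (by linarith) hΔj
      · have hx0 : x ≤ t j := by
          have := hyt j
          nlinarith
        have hx1 : x ≤ t (j + 1) := by
          rw [hts]
          linarith
        have h2 := (hL (L * -(y - j)) (le_mul_of_one_le_right hL0 h1)).2
        rw [mul_neg, neg_neg] at h2
        rw [min_eq_left hx1, min_eq_left hx0, sub_self, zero_sub, abs_neg,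
          abs_of_nonneg (mul_nonneg hΔj hs0)]
        exact mul_le_mul_of_nonneg_left h2 hΔj
  calc _ ≤ ∑ j ∈ Finset.range M, (Δ j * κ + if |y - j| < 1 then ε / 4 else 0) :=
        (Finset.abs_sum_le_sum_abs _ _).trans (Finset.sum_le_sum hterm)
    _ ≤ ε / 4 + 2 * (ε / 4) := by
        rw [Finset.sum_add_distrib, ← Finset.sum_mul, hΔsum, ← Finset.sum_filter,
          Finset.sum_const, nsmul_eq_mul]
        have hcard : (((Finset.range M).filter fun j : ℕ => |y - j| < 1).card : ℝ) ≤ 2 := by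
          exact_mod_cast card_filter_abs_sub_lt_one_le M hy0
        have := mul_le_mul_of_nonneg_right hcard (by positivity : 0 ≤ ε / 4)
        linarith
    _ < ε := by linarith

/-! ### Density of ridge functions -/

section RidgeDensity

variable {E : Type*} [NormedAddCommGroup E] [NormedSpace ℝ E]

/-- The ridge function `v ↦ lnSigmoid (w v + b)` on `C`. -/
def ridge (C : Set E) (p : (E →L[ℝ] ℝ) × ℝ) : C(C, ℝ) where
  toFun v := lnSigmoid (p.1 v + p.2)
  continuous_toFun := continuous_lnSigmoid.comp (by fun_prop)

/-- The function `v ↦ exp (w v)` on `C`. -/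
def expRidge (C : Set E) (w : E →L[ℝ] ℝ) : C(C, ℝ) where
  toFun v := Real.exp (w v)
  continuous_toFun := by fun_prop

theorem const_mem_span_ridge (C : Set E) (a : ℝ) :
    ContinuousMap.const C a ∈ Submodule.span ℝ (Set.range (ridge C)) := by
  have h : lnSigmoid 1 ≠ 0 := by
    rw [lnSigmoid]
    positivity
  have : ContinuousMap.const C a = (a / lnSigmoid 1) • ridge C (0, 1) := by
    ext v
    simp [ridge, h]
  rw [this]
  exact Submodule.smul_mem _ _ (Submodule.subset_span (Set.mem_range_self _))

variable {Y : Type*} [NormedAddCommGroup Y] [NormedSpace ℝ Y]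

/-- The span of the vector-valued ridge functions `v ↦ lnSigmoid (w v + b) • y`. -/
def ridgeSpan (E Y : Type*) [NormedAddCommGroup E] [NormedSpace ℝ E] [NormedAddCommGroup Y]
    [NormedSpace ℝ Y] : Submodule ℝ (E → Y) :=
  Submodule.span ℝ (Set.range fun q : ((E →L[ℝ] ℝ) × ℝ) × Y =>
    fun v => lnSigmoid (q.1.1 v + q.1.2) • q.2)

theorem exists_mem_ridgeSpan_eq_smul (C : Set E) {g : C(C, ℝ)}
    (hg : g ∈ Submodule.span ℝ (Set.range (ridge C))) (y : Y) :
    ∃ F ∈ ridgeSpan E Y, ∀ v : C, F v = g v • y := by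
  induction hg using Submodule.span_induction with
  | mem g hg =>
    obtain ⟨p, rfl⟩ := hg
    exact ⟨_, Submodule.subset_span ⟨(p, y), rfl⟩, fun v => rfl⟩
  | zero => exact ⟨0, Submodule.zero_mem _, by simp⟩
  | add g g' _ _ hg hg' =>
    obtain ⟨F, hF, h⟩ := hg
    obtain ⟨F', hF', h'⟩ := hg'
    exact ⟨F + F', Submodule.add_mem _ hF hF', fun v => by simp [h, h', add_smul]⟩
  | smul a g _ hg =>
    obtain ⟨F, hF, h⟩ := hg
    exact ⟨a • F, Submodule.smul_mem _ _ hF, fun v => by simp [h, mul_smul]⟩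

variable (C : Set E) [CompactSpace C]

/-- The function `exp ∘ w` is a monotone function of the single variable `w v`, which stays in a
bounded interval on the compact set `C`. -/
theorem expRidge_mem_closure_span_ridge (w : E →L[ℝ] ℝ) :
    expRidge C w ∈ (Submodule.span ℝ (Set.range (ridge C))).topologicalClosure := by
  rw [← SetLike.mem_coe, Submodule.topologicalClosure_coe, Metric.mem_closure_iff]
  intro ε hε
  let wC : C(C, ℝ) := ⟨fun v => w v, by fun_prop⟩
  obtain ⟨M, l, t, Δ, hM⟩ := exists_sum_lnSigmoid_approx Real.continuous_exp Real.exp_monotone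
    (R := ‖wC‖ + 1) (by positivity) hε
  refine ⟨ContinuousMap.const C (Real.exp (-(‖wC‖ + 1))) + ∑ j ∈ Finset.range M,
    Δ j • ((1 / 2 : ℝ) • (ContinuousMap.const C 1 + ridge C (l • w, -(l * t j)))), ?_, ?_⟩
  · refine Submodule.add_mem _ (const_mem_span_ridge C _) (Submodule.sum_mem _ fun j _ => ?_)
    exact Submodule.smul_mem _ _ (Submodule.smul_mem _ _ (Submodule.add_mem _
      (const_mem_span_ridge C _) (Submodule.subset_span (Set.mem_range_self _))))
  · rw [ContinuousMap.dist_lt_iff hε]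
    intro v
    have hv := abs_le.1 (wC.norm_coe_le_norm v)
    have h1 := hM (w v) ⟨by linarith [hv.1, show wC v = w v from rfl],
      by linarith [hv.2, show wC v = w v from rfl]⟩
    rw [Real.dist_eq]
    convert h1 using 2
    simp only [ContinuousMap.add_apply, ContinuousMap.sum_apply, ContinuousMap.smul_apply,
      ContinuousMap.const_apply, smul_eq_mul, expRidge, ridge, ContinuousMap.coe_mk,
      smul_apply]
    congr 2
    refine Finset.sum_congr rfl fun j _ => ?_
    rw [mul_sub, sub_eq_add_neg (l * w v)]
    ring

/-- Ridge functions of `lnSigmoid` span a dense subspace. -/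
theorem closure_span_ridge_eq_top :
    (Submodule.span ℝ (Set.range (ridge C))).topologicalClosure = ⊤ := by
  set V := (Submodule.span ℝ (Set.range (ridge C))).topologicalClosure with hV
  set A := Algebra.adjoin ℝ (Set.range (expRidge C)) with hA
  -- Products of exponentials are exponentials, so the algebra they generate is merely their linear
  -- span.
  have hmon : (Submonoid.closure (Set.range (expRidge C)) : Set C(C, ℝ)) ⊆
      Set.range (expRidge C) := by
    intro g hg
    induction hg using Submonoid.closure_induction with
    | mem g hg => exact hg
    | one => exact ⟨0, by ext v; simp [expRidge]⟩
    | mul g g' _ _ hg hg' =>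
      obtain ⟨w, rfl⟩ := hg
      obtain ⟨w', rfl⟩ := hg'
      exact ⟨w + w', by ext v; simp [expRidge, Real.exp_add]⟩
  have hAV : ∀ g ∈ A, g ∈ V := by
    intro g hg
    rw [← Subalgebra.mem_toSubmodule,
      Algebra.adjoin_eq_span_of_subset ℝ (hmon.trans Submodule.subset_span)] at hg
    refine Submodule.span_le.2 ?_ hg
    rintro _ ⟨w, rfl⟩
    exact expRidge_mem_closure_span_ridge C w
  have hsep : A.SeparatesPoints := by
    intro u v huv
    obtain ⟨w, hw⟩ := SeparatingDual.exists_separating_of_ne (R := ℝ)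
      (fun h => huv (Subtype.ext h) : (u : E) ≠ v)
    exact ⟨expRidge C w, ⟨expRidge C w, Algebra.subset_adjoin (Set.mem_range_self w), rfl⟩,
      fun h => hw (Real.exp_injective h)⟩
  have htop := ContinuousMap.subalgebra_topologicalClosure_eq_top_of_separatesPoints A hsep
  rw [eq_top_iff]
  intro g _
  have hg : g ∈ A.topologicalClosure := htop ▸ Algebra.mem_top
  have hcl : IsClosed (V : Set C(C, ℝ)) := Submodule.isClosed_topologicalClosure _
  exact closure_minimal (fun g hg => hAV g hg) hcl hg

theorem exists_mem_ridgeSpan_approx_smul (g : C(C, ℝ)) (y : Y) {ε : ℝ} (hε : 0 < ε) :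
    ∃ F ∈ ridgeSpan E Y, ∀ v : C, ‖g v • y - F v‖ < ε := by
  have hg : g ∈ (Submodule.span ℝ (Set.range (ridge C))).topologicalClosure := by
    rw [closure_span_ridge_eq_top]
    trivial
  rw [← SetLike.mem_coe, Submodule.topologicalClosure_coe, Metric.mem_closure_iff] at hg
  obtain ⟨p, hp, hgp⟩ := hg (ε / (‖y‖ + 1)) (by positivity)
  obtain ⟨F, hF, hFp⟩ := exists_mem_ridgeSpan_eq_smul C hp y
  refine ⟨F, hF, fun v => ?_⟩
  have h1 : ‖g v - p v‖ < ε / (‖y‖ + 1) := by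
    rw [← dist_eq_norm]
    exact (ContinuousMap.dist_apply_le_dist v).trans_lt hgp
  rw [hFp, ← sub_smul, norm_smul]
  rw [lt_div_iff₀ (by positivity)] at h1
  exact (mul_le_mul_of_nonneg_left (by linarith) (norm_nonneg _)).trans_lt h1

/-- Vector-valued ridge functions of `lnSigmoid` are dense among the continuous functions. -/
theorem exists_mem_ridgeSpan_approx (f : C(C, Y)) {ε : ℝ} (hε : 0 < ε) :
    ∃ F ∈ ridgeSpan E Y, ∀ v : C, ‖f v - F v‖ < ε := by
  obtain ⟨N, y, hy⟩ := (isCompact_range f.continuous).exists_isFiniteNet (half_pos hε)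
  have hnet : ∀ v, ∃ i, ‖f v - y i‖ < ε / 2 := fun v => hy.2 _ (Set.mem_range_self v)
  have hwc : ∀ i, Continuous fun v => lsWeight (ε / 2) y i (f v) := fun i =>
    (continuous_lsWeight _ _ _).comp f.continuous
  -- A partition of unity pulled back from a net of the compact range of `f`: `∑ i, g i v • y i` is
  -- the Leray-Schauder mapping of `f v`, and only the scalar functions `g i` remain to be
  -- approximated.
  let g : Fin N → C(C, ℝ) := fun i =>
    ⟨fun v => (∑ i, lsWeight (ε / 2) y i (f v))⁻¹ * lsWeight (ε / 2) y i (f v),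
      ((continuous_finsetSum _ fun i _ => hwc i).inv₀
        fun v => (sum_lsWeight_pos (hnet v)).ne').mul (hwc i)⟩
  choose F hF hFg using fun i => exists_mem_ridgeSpan_approx_smul C (g i) (y i)
    (ε := ε / (2 * (N + 1))) (by positivity)
  refine ⟨∑ i, F i, Submodule.sum_mem _ fun i _ => hF i, fun v => ?_⟩
  have h1 := norm_sub_lsMap_le (hnet v)
  have h2 : ‖(lsMap (ε / 2) y (f v) : Y) - (∑ i, F i) v‖ ≤ N * (ε / (2 * (N + 1))) := by
    rw [coe_lsMap, Finset.sum_apply, ← Finset.sum_sub_distrib]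
    refine (norm_sum_le_of_le _ fun i _ => (hFg i v).le).trans ?_
    simp
  have h3 : N * (ε / (2 * (N + 1))) < ε / 2 := by
    rw [← mul_div_assoc, div_lt_div_iff₀ (by positivity) (by positivity)]
    nlinarith
  linarith [norm_sub_le_norm_sub_add_norm_sub (f v) (lsMap (ε / 2) y (f v)) ((∑ i, F i) v)]

end RidgeDensity

/-! ### Ridge approximations with distinct values on a finite set -/

section Genericity

variable {E : Type*} [NormedAddCommGroup E] [NormedSpace ℝ E]
  {Y : Type*} [NormedAddCommGroup Y] [NormedSpace ℝ Y]

theorem exists_sum_ridge_approx {C : Set E} (hC : IsCompact C) {f : E → Y} (hf : Continuous f)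
    {ε : ℝ} (hε : 0 < ε) (r : ℕ) :
    ∃ (n : ℕ) (w : Fin n → E →L[ℝ] ℝ) (b : Fin n → ℝ) (y : Fin n → Y), r ≤ n ∧
      ∀ v ∈ C, ‖f v - ∑ i, lnSigmoid (w i v + b i) • y i‖ < ε := by
  have := isCompact_iff_compactSpace.1 hC
  obtain ⟨F, hF, hfF⟩ := exists_mem_ridgeSpan_approx C ⟨fun v => f v, by fun_prop⟩ hε
  obtain ⟨m, c, g, rfl⟩ := Submodule.mem_span_set'.1 hF
  choose q hq using fun i => (g i).2
  -- Prepending `r` terms with zero output vector makes the number of terms at least `r`.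
  refine ⟨r + m, Fin.append 0 fun i => (q i).1.1, Fin.append 0 fun i => (q i).1.2,
    Fin.append 0 fun i => c i • (q i).2, Nat.le_add_right r m, fun v hv => ?_⟩
  have h := hfF ⟨v, hv⟩
  change ‖f v - (∑ i, c i • (g i : E → Y)) v‖ < ε at h
  convert h using 3
  rw [Fin.sum_univ_add, Finset.sum_apply]
  simp only [Fin.append_left, Fin.append_right, Pi.zero_apply, smul_zero, Finset.sum_const_zero,
    zero_add, Pi.smul_apply, ← hq]
  exact Finset.sum_congr rfl fun i _ => smul_comm _ _ _

/-- Finitely many points and affine functions can be separated by one family of affine functions. -/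
theorem exists_injective_affine [FiniteDimensional ℝ E] {S : Set E} (hS : S.Finite) (n : ℕ) :
    ∃ (θ : E →L[ℝ] ℝ) (R : ℝ), ∀ i j : Fin n, ∀ u ∈ S, ∀ v ∈ S,
      θ u + R * (i : ℕ) = θ v + R * (j : ℕ) → i = j ∧ u = v := by
  have := hS.to_subtype
  -- A functional nonzero on the finitely many differences of distinct points separates `S`;
  -- afterwards `R` only has to avoid finitely many quotients.
  obtain ⟨θ, hθ⟩ := Module.exists_dual_forall_apply_ne_zero (K := ℝ)
    (fun p : {p : S × S // p.1 ≠ p.2} => ((p.1.1 : E) - p.1.2)) fun p =>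
      sub_ne_zero.2 fun h => p.2 (Subtype.ext h)
  have hR : ∀ᶠ R : ℝ in Filter.atTop, ∀ p : (S × S) × (Fin n × Fin n), p.2.1 ≠ p.2.2 →
      θ p.1.1 + R * (p.2.1 : ℕ) ≠ θ p.1.2 + R * (p.2.2 : ℕ) := by
    rw [Filter.eventually_all]
    rintro ⟨⟨u, v⟩, i, j⟩
    by_cases hij : i = j
    · simp [hij]
    have hij' : ((i : ℕ) : ℝ) - (j : ℕ) ≠ 0 := by
      rw [sub_ne_zero]
      exact_mod_cast fun h => hij (Fin.ext h)
    filter_upwards [Filter.eventually_ne_atTop ((θ v - θ u) / (((i : ℕ) : ℝ) - (j : ℕ)))]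
      with R hR _ h
    apply hR
    rw [eq_div_iff hij']
    linear_combination h
  obtain ⟨R, hR⟩ := hR.exists
  refine ⟨LinearMap.toContinuousLinearMap θ, R, fun i j u hu v hv h => ?_⟩
  have hij : i = j := by
    by_contra hij
    exact hR ((⟨u, hu⟩, ⟨v, hv⟩), (i, j)) hij h
  refine ⟨hij, ?_⟩
  by_contra huv
  refine hθ ⟨(⟨u, hu⟩, ⟨v, hv⟩), fun h => huv (congrArg Subtype.val h)⟩ ?_
  rw [hij] at h
  have h' : θ u = θ v := add_right_cancel h
  simp [h']

/-- The affine functions in a uniform approximation by ridge functions can be chosen so that their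
values at the points of a finite set are all distinct. -/
theorem exists_sum_ridge_approx_injective [FiniteDimensional ℝ E] {C : Set E} (hC : IsCompact C)
    {f : E → Y} (hf : Continuous f) {ε : ℝ} (hε : 0 < ε) (r : ℕ) {S : Set E} (hS : S.Finite) :
    ∃ (n : ℕ) (w : Fin n → E →L[ℝ] ℝ) (b : Fin n → ℝ) (y : Fin n → Y), r ≤ n ∧
      (∀ v ∈ C, ‖f v - ∑ i, lnSigmoid (w i v + b i) • y i‖ < ε) ∧
      ∀ i j : Fin n, ∀ u ∈ S, ∀ v ∈ S, w i u + b i = w j v + b j → i = j ∧ u = v := by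
  obtain ⟨n, w, b, y, hn, hfw⟩ := exists_sum_ridge_approx hC hf hε r
  obtain ⟨θ, R, hθ⟩ := exists_injective_affine hS n
  have := hS.to_subtype
  -- The strict estimate is an open condition in `t`, uniformly over the compact set `C`.
  have hclose : ∀ᶠ t : ℝ in nhds 0, ∀ v ∈ C,
      ‖f v - ∑ i, lnSigmoid ((w i + t • θ) v + (b i + t * (R * (i : ℕ)))) • y i‖ < ε := by
    refine hC.eventually_forall_of_forall_eventually fun v hv => ?_
    have hcont : Continuous fun p : ℝ × E =>
        ‖f p.2 - ∑ i, lnSigmoid ((w i + p.1 • θ) p.2 + (b i + p.1 * (R * (i : ℕ)))) • y i‖ := by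
      refine (hf.comp continuous_snd).sub (continuous_finsetSum _ fun i _ => ?_) |>.norm
      refine (continuous_lnSigmoid.comp ?_).smul continuous_const
      simp only [add_apply, smul_apply, smul_eq_mul]
      fun_prop
    refine hcont.continuousAt.eventually_lt continuousAt_const ?_
    simpa using hfw v hv
  -- Each difference of values is `α + t * β` with `β ≠ 0`, hence nonzero for all small `t ≠ 0`;
  -- there are finitely many differences.
  have hinj : ∀ᶠ t : ℝ in nhdsWithin 0 {0}ᶜ, ∀ p : (S × S) × (Fin n × Fin n),
      ¬ (p.2.1 = p.2.2 ∧ p.1.1 = p.1.2) →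
      (w p.2.1 + t • θ) p.1.1 + (b p.2.1 + t * (R * (p.2.1 : ℕ))) ≠
        (w p.2.2 + t • θ) p.1.2 + (b p.2.2 + t * (R * (p.2.2 : ℕ))) := by
    rw [Filter.eventually_all]
    rintro ⟨⟨u, v⟩, i, j⟩
    by_cases hij : i = j ∧ u = v
    · simp [hij]
    set β : ℝ := (θ u + R * (i : ℕ)) - (θ v + R * (j : ℕ)) with hβ
    have hβ0 : β ≠ 0 := fun h => hij
      ((hθ i j u u.2 v v.2 (sub_eq_zero.1 h)).imp_right Subtype.ext)
    set α : ℝ := (w i u + b i) - (w j v + b j) with hα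
    have key : ∀ᶠ t : ℝ in nhdsWithin 0 {0}ᶜ, α + t * β ≠ 0 := by
      by_cases hα0 : α = 0
      · filter_upwards [self_mem_nhdsWithin] with t ht
        rw [hα0, zero_add]
        exact mul_ne_zero ht hβ0
      · have hc : ContinuousAt (fun t : ℝ => α + t * β) 0 := by fun_prop
        exact (hc.eventually_ne (by simpa using hα0)).filter_mono nhdsWithin_le_nhds
    filter_upwards [key] with t ht _ h
    apply ht
    simp only [add_apply, smul_apply, smul_eq_mul] at h
    rw [hα, hβ]
    linear_combination h
  obtain ⟨t, ht, ht'⟩ := ((hclose.filter_mono nhdsWithin_le_nhds).and hinj).exists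
  refine ⟨n, fun i => w i + t • θ, fun i => b i + t * (R * (i : ℕ)), y, hn, ht,
    fun i j u hu v hv h => ?_⟩
  by_contra hne
  exact ht' ((⟨u, hu⟩, ⟨v, hv⟩), (i, j)) (fun h => hne (h.imp_right (congrArg Subtype.val))) h

end Genericity

/-! ### Affine maps in coordinates -/

theorem sum_dite_lt_eq {k n : ℕ} (hkn : k ≤ n) (f : Fin k → ℝ) :
    ∑ j : Fin n, (if h : (j : ℕ) < k then f ⟨j, h⟩ else 0) = ∑ a, f a := by
  obtain ⟨r, rfl⟩ := Nat.exists_eq_add_of_le hkn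
  rw [Fin.sum_univ_add]
  simp

/-- A family of affine functions is the composition of `coordTokens`, a translation and a matrix
with row sums one, if there are two tokens more than coordinates. -/
theorem exists_matrix_coordTokens {E : Type*} [AddCommGroup E] [Module ℝ E] {k n : ℕ}
    (bas : Module.Basis (Fin k) ℝ E) (hn : k + 2 ≤ n) (w : Fin n → E →ₗ[ℝ] ℝ) (b : Fin n → ℝ) :
    ∃ (G : Matrix (Fin n) (Fin n) ℝ) (c : Fin n → ℝ), (∀ i, ∑ j, G i j = 1) ∧
      ∀ v i, (G *ᵥ (coordTokens bas n v + c)) i = w i v + b i := by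
  -- Two padding positions: token `p` is shifted to the constant `1`, so its column carries the
  -- biases; token `q` remains `0`, so its column can correct the row sums freely.
  let p : Fin n := ⟨k, by omega⟩
  let q : Fin n := ⟨k + 1, by omega⟩
  let G₀ : Matrix (Fin n) (Fin n) ℝ := fun i j =>
    (if h : (j : ℕ) < k then w i (bas ⟨j, h⟩) else 0) + if j = p then b i else 0
  refine ⟨fun i j => G₀ i j + if j = q then 1 - ∑ j, G₀ i j else 0, Pi.single p 1,
    fun i => by simp [Finset.sum_add_distrib], fun v i => ?_⟩
  have hp : coordTokens bas n v p = 0 := by simp [coordTokens, p]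
  have hq : coordTokens bas n v q + (Pi.single p 1 : Fin n → ℝ) q = 0 := by
    simp [coordTokens, p, q]
  have hw : w i v = ∑ a, w i (bas a) * bas.repr v a := by
    calc w i v = w i (∑ a, bas.repr v a • bas a) := by rw [bas.sum_repr]
      _ = _ := by simp only [map_sum, map_smul, smul_eq_mul, mul_comm]
  have hlin : ∀ j : Fin n, G₀ i j * (coordTokens bas n v j + (Pi.single p 1 : Fin n → ℝ) j) =
      (if h : (j : ℕ) < k then w i (bas ⟨j, h⟩) * bas.repr v ⟨j, h⟩ else 0) +
        if j = p then b i else 0 := by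
    intro j
    by_cases hj : (j : ℕ) < k
    · have hjp : j ≠ p := fun h => by simp [h, p] at hj
      simp [G₀, coordTokens, hj, hjp]
    · by_cases hjp : j = p
      · simp [G₀, hjp, hp]
        simp [p]
      · simp [G₀, hj, hjp]
  simp only [Matrix.mulVec, dotProduct, Pi.add_apply, add_mul, Finset.sum_add_distrib, hlin,
    ite_mul, zero_mul, Finset.sum_ite_eq', Finset.mem_univ, if_true, hq, mul_zero, add_zero]
  rw [sum_dite_lt_eq (by omega) (fun a => w i (bas a) * bas.repr v a), hw]

end

/-! ### The approximation theorem -/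

theorem mainTheorem2
    {X : Type*} [NormedAddCommGroup X] [NormedSpace ℝ X] [CompleteSpace X]
    {Y : Type*} [NormedAddCommGroup Y] [NormedSpace ℝ Y] [CompleteSpace Y]
    (T : X → Y) (hT : Continuous T) (K : Set X) (hK : IsCompact K)
    (η : ℝ) (hη : 0 < η) (ε : ℝ) (hε : 0 < ε) :
    ∃ 𝔗 : LeraySchauderTransformer K Y η, ∀ x ∈ K, ‖T x - 𝔗.eval x‖ < ε := by
  -- Only `x` is confined to `K`: the point `z` will be `P x`, which may lie outside `K`.
  obtain ⟨δ₀, hδ₀, hTδ⟩ : ∃ δ₀ > 0, ∀ x ∈ K, ∀ z, ‖x - z‖ < δ₀ → ‖T x - T z‖ < ε / 2 := by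
    obtain ⟨δ₀, hδ₀, h⟩ := Metric.mem_uniformity_dist.1
      (hK.uniformContinuousAt_of_continuousAt T (fun _ _ => hT.continuousAt)
        (Metric.dist_mem_uniformity (half_pos hε)))
    refine ⟨δ₀, hδ₀, fun x hx z hxz => ?_⟩
    have := h (a := x) (b := z) (by rwa [dist_eq_norm]) hx
    rwa [← dist_eq_norm]
  set δ := δ₀ / 2 with hδ
  have hδpos : 0 < δ := half_pos hδ₀
  obtain ⟨N, net, hnet⟩ := hK.exists_isFiniteNet hδpos
  set E := Submodule.span ℝ (Set.range net) with hE
  have : FiniteDimensional ℝ E := FiniteDimensional.span_of_finite ℝ (Set.finite_range net)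
  have : ProperSpace E := FiniteDimensional.proper ℝ E
  obtain ⟨r, hr⟩ := hK.isBounded.exists_norm_le
  let bas := Module.finBasis ℝ E
  set k := Module.finrank ℝ E with hk
  let pt : Fin N → E := fun i => ⟨net i, Submodule.subset_span (Set.mem_range_self i)⟩
  -- The ball of radius `r + δ` in `E` contains `P x` for every `x ∈ K` and is compact; `k + 2`
  -- reserves the two padding tokens.
  obtain ⟨n, w, b, y, hn, happrox, hinj⟩ := exists_sum_ridge_approx_injective
    (isCompact_closedBall (0 : E) (r + δ)) (hT.comp continuous_subtype_val) (half_pos hε) (k + 2)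
    (Set.finite_range pt)
  obtain ⟨G, c, hG, hGw⟩ := exists_matrix_coordTokens bas hn (fun i => (w i : E →ₗ[ℝ] ℝ)) b
  obtain ⟨W, hW, hctx⟩ := exists_transformer_eval_eq_lnSigmoid hη G hG c
  refine ⟨{
    δ := δ
    δ_pos := hδpos
    N := N
    net := net
    isFiniteNet := hnet
    k := k
    basis := bas
    n := n
    two_le_n := by omega
    k_le_n := by omega
    transformer := W
    contextual := hctx _ ⟨?_, ?_⟩
    outVec := y }, fun x hx => ?_⟩
  · rintro _ ⟨a, rfl⟩ i j h
    simp only [hGw] at h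
    exact (hinj i j _ ⟨a, rfl⟩ _ ⟨a, rfl⟩ h).1
  · rintro _ ⟨a, rfl⟩ _ ⟨a', rfl⟩ hne i j h
    simp only [hGw] at h
    exact hne (congrArg _ (hinj i j _ ⟨a, rfl⟩ _ ⟨a', rfl⟩ h).2)
  · have hPx := norm_sub_lsMap_le (hnet.2 x hx)
    have hball : lsMap δ net x ∈ Metric.closedBall (0 : E) (r + δ) := by
      rw [mem_closedBall_zero_iff]
      change ‖(lsMap δ net x : X)‖ ≤ r + δ
      have h1 := norm_sub_norm_le (lsMap δ net x : X) x
      rw [norm_sub_rev] at h1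
      linarith [hr x hx]
    have h1 := hTδ x hx _ (hPx.trans_lt (half_lt_self hδ₀))
    have h2 := happrox _ hball
    simp only [LeraySchauderTransformer.eval, hW, hGw]
    have h3 := norm_sub_le_norm_sub_add_norm_sub (T x) (T (lsMap δ net x))
      (∑ i, lnSigmoid (w i (lsMap δ net x) + b i) • y i)
    refine h3.trans_lt ?_
    simp only [Function.comp_apply] at h2
    linarith
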